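/- Let $W$ be a finite or countably infinite set, let $\mathscr F$ be the free semigroup (with identity $e$, the empty word) freely generated by $W$, i.e. the set of all finite words in $W$ under concatenation, and let $\mu$ be a probability measure on $\mathscr F$ with $\mu(W)=1$. Let $\mathbf P$ be the law of the path $\boldsymbol x=(x_n)_{n\ge 0}$, $x_0=e$, $x_n=h_1h_2\cdots h_n$, of the random walk whose increments $h_1,h_2,\dots$ are independent with distribution $\mu$. Let $(\Omega,\lambda)$ be a probability space and let $\tau:\mathscr F^{\mathbb Z_+}\times\Omega\to\{0,1,2,\dots\}\cup\{\infty\}$ be a bounded randomized stopping time: $\tau$ is jointly measurable; for every $\omega\in\Omega$ the function $\tau(\cdot,\omega)$ is a stopping time, i.e. for every integer $s\ge 0$ the set $\{\boldsymbol x:\tau(\boldsymbol x,\omega)=s\}$ belongs to the $\sigma$-algebra generated by the positions $x_0,\dots,x_s$; and there is an integer $M$ with $\tau\le M$ $\mathbf P\otimes\lambda$-almost everywhere. Put $$\mu_\tau(g)=(\mathbf P\otimes\lambda)\{(\boldsymbol x,\omega): x_{\tau(\boldsymbol x,\omega)}=g\}\quad(g\in\mathscr F),\qquad \mu_{\tau,t}=t\mu+(1-t)\mu_\tau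 .$$ For a probability measure $\nu$ on $\mathscr F$ let $H^+(\mathscr F,\nu)$ be the set of all functions $f:\mathscr F\to[0,\infty)$ such that for every $g\in\mathscr F$ the series $\sum_{h\in\mathscr F}f(gh)\,\nu(h)$ converges absolutely and has sum $f(g)$. Then for every real $t$ with $0<t\le 1$, $$H^+(\mathscr F,\mu)=H^+(\mathscr F,\mu_{\tau,t}).$$ -/

import Mathlib

open MeasureTheory ProbabilityTheory

noncomputable section

namespace RandomWalk

theorem measurable_stopped {S : Type*} [MeasurableSpace S] {Ω : Type*} [MeasurableSpace Ω] {τ : (ℕ → S) × Ω → ℕ∞}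
    (hτ : Measurable τ) : Measurable fun p : (ℕ → S) × Ω => p.1 (τ p).toNat := by
  have h1 : Measurable fun p : (ℕ → S) × Ω => (p.1, (τ p).toNat) :=
    measurable_fst.prodMk ((Measurable.of_discrete (f := ENat.toNat)).comp hτ)
  have h2 : Measurable fun q : (ℕ → S) × ℕ => q.1 q.2 :=
    measurable_from_prod_countable_left fun n => measurable_pi_apply n
  exact h2.comp h1

variable {Γ : Type*} [Monoid Γ]

/-- The path `(1, h 0, h 0 * h 1, h 0 * h 1 * h 2, …)` with increments `h 0, h 1, h 2, …`. -/
def path (h : ℕ → Γ) : ℕ → Γ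
  | 0 => 1
  | n + 1 => path h n * h n

variable [MeasurableSpace Γ]

/-- The law on the path space of the random walk issued from `1` whose increments are independent
and `μ`-distributed: the image under `path` of the infinite product of copies of `μ`. -/
def pathMeasure (μ : Measure Γ) [IsProbabilityMeasure μ] : Measure (ℕ → Γ) :=
  (Measure.infinitePi fun _ : ℕ => μ).map path

/-- An almost surely finite randomized stopping time for the random walk `(Γ, μ)`, with auxiliary
randomness from the probability space `(Ω, P)`: a jointly measurable map each of whose sections
`τ (·, ω)` is a stopping time for the filtration generated by the positions of the walk, the
`n`-th `σ`-algebra being that generated by `x 0, …, x n`. -/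
structure IsRandomizedStoppingTime (μ : Measure Γ) [IsProbabilityMeasure μ]
    {Ω : Type*} [MeasurableSpace Ω] (P : Measure Ω) (τ : (ℕ → Γ) × Ω → ℕ∞) : Prop where
  measurable : Measurable τ
  isStoppingTime : ∀ ω, IsStoppingTime (Filtration.piLE (X := fun _ : ℕ => Γ)) fun x => τ (x, ω)
  ae_finite : ∀ᵐ p ∂(pathMeasure μ).prod P, τ p ≠ ⊤

/-- The transformed measure `μ_τ`: the distribution of the position `x_τ` of the walk at the
(almost surely finite) time `τ`. -/
def stoppedMeasure (μ : Measure Γ) [IsProbabilityMeasure μ]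
    {Ω : Type*} [MeasurableSpace Ω] (P : Measure Ω) (τ : (ℕ → Γ) × Ω → ℕ∞) : Measure Γ :=
  ((pathMeasure μ).prod P).map fun p => p.1 (τ p).toNat

/-- The convex combination `t μ + (1 - t) μ_τ`. -/
def mixedMeasure (μ : Measure Γ) [IsProbabilityMeasure μ]
    {Ω : Type*} [MeasurableSpace Ω] (P : Measure Ω) (τ : (ℕ → Γ) × Ω → ℕ∞) (t : ℝ) : Measure Γ :=
  ENNReal.ofReal t • μ + ENNReal.ofReal (1 - t) • stoppedMeasure μ P τ

/-- `f` is `μ`-harmonic: for every `g` the series `∑ h, f (g h) μ(h)` converges absolutely and its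
sum is `f g`. -/
def IsHarmonic (μ : Measure Γ) (f : Γ → ℝ) : Prop :=
  ∀ g : Γ, (Summable fun h : Γ => |f (g * h) * μ.real {h}|) ∧
    ∑' h : Γ, f (g * h) * μ.real {h} = f g

/-- The set `H⁺(Γ, μ)` of positive (that is, nonnegative) `μ`-harmonic functions. -/
def positiveHarmonic (μ : Measure Γ) : Set (Γ → ℝ) :=
  {f | (∀ g, 0 ≤ f g) ∧ IsHarmonic μ f}

section Sanity

variable [Countable Γ] [DiscreteMeasurableSpace Γ]

theorem measurable_path : Measurable (path : (ℕ → Γ) → ℕ → Γ) := by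
  refine measurable_pi_lambda _ fun n => ?_
  induction n with
  | zero => exact measurable_const
  | succ n ih => exact ih.mul (measurable_pi_apply n)

instance instIsProbabilityMeasurePathMeasure (μ : Measure Γ) [IsProbabilityMeasure μ] : IsProbabilityMeasure (pathMeasure μ) :=
  Measure.isProbabilityMeasure_map measurable_path.aemeasurable

/-- `μ_τ(g)` is the probability that `τ` is finite and `x_τ = g`. -/
theorem stoppedMeasure_singleton (μ : Measure Γ) [IsProbabilityMeasure μ]
    {Ω : Type*} [MeasurableSpace Ω] {P : Measure Ω} {τ : (ℕ → Γ) × Ω → ℕ∞}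
    (hτ : IsRandomizedStoppingTime μ P τ) (g : Γ) :
    stoppedMeasure μ P τ {g} =
      ((pathMeasure μ).prod P) {p | ∃ n : ℕ, τ p = n ∧ p.1 n = g} := by
  rw [stoppedMeasure, Measure.map_apply (measurable_stopped hτ.measurable) (.of_discrete)]
  refine measure_congr ?_
  filter_upwards [hτ.ae_finite] with p hp
  refine propext ?_
  obtain ⟨n, hn⟩ := ENat.ne_top_iff_exists.mp hp
  constructor
  · intro h
    change p.1 (τ p).toNat = g at h
    exact ⟨n, hn.symm, by simpa [← hn] using h⟩
  · rintro ⟨m, hm, h⟩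
    change p.1 (τ p).toNat = g
    simpa [hm] using h

end Sanity

end RandomWalk

end

/-! In a free monoid the position of the walk records its whole past. Hence $\mu_\tau(l)$ is the
product of the letter weights of $l$ times the conditional probability $a(l)$ of stopping once $l$
is read (`stoppedMeasure_eq_wordWeight_mul`). Along a word of positive weight, $a$ sums over
prefixes to at most 1, and to exactly 1 once the length reaches the bound on $\tau$. That
$\mu$-harmonic functions are harmonic for the mixture is then optional stopping at a bounded time
(`tsum_stopped_of_harmonic`).

For the converse, discard the trivial jumps of the mixture. The remaining jump density $\beta$ has
bounded range $K$ and $\beta(w)\ge t$ on letters of positive weight. Let $u_n(l)$ be the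
probability, relative to the weight of $l$, that the jump walk enters the words of length at least
$n$ at $l$. Then $F$ is harmonic for each of these entry laws (`tsum_firstEntry`). Expanding $F(g)$
at level $n+1$, and each $F(gw)$ at level $n$, writes $F(g)$ and $\sum_w p(w)F(gw)$ as sums over the
same words $gwl$, with coefficients $u_{n+1}(wl)$ and $u_n(l)$. Along the fixed word $wl$ these are
hitting probabilities of one renewal-type chain started at positions 0 and 1; the weight $t$ of unit
steps makes their difference exponentially small in $n$ (`IsAveraging.abs_sub_le`).

This pointwise estimate can be summed against an unbounded $F$ because $u_n(l)\ge t^K$ when $|l|=n$,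
so the $F$-mass of the words of each length is at most $t^{-K}F(g)$
(`IsStoppingDensity.pow_mul_tsum_length_eq_le`). Letting $n\to\infty$ gives harmonicity. -/

namespace RandomWalk

open scoped ENNReal NNReal
open Finset (range)

/-! ### Contraction of oscillation for backward averaging recursions -/

section Averaging

/-- Below the level `N`, the value of `V` at `j` is an average of its next `M` values, of which the
first has weight at least `t`. -/
structure IsAveraging (V : ℕ → ℝ) (β : ℕ → ℕ → ℝ) (M N : ℕ) (t : ℝ) : Prop where
  pos : 0 < M
  nonneg : ∀ j < N, ∀ i, 0 ≤ β j i
  sum_eq : ∀ j < N, ∑ i ∈ range M, β j i = 1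
  le_first : ∀ j < N, t ≤ β j 0
  eq_sum : ∀ j < N, V j = ∑ i ∈ range M, β j i * V (j + i + 1)

variable {V : ℕ → ℝ} {β : ℕ → ℕ → ℝ} {M N : ℕ} {t : ℝ}

theorem IsAveraging.neg (h : IsAveraging V β M N t) : IsAveraging (fun j => -V j) β M N t :=
  ⟨h.pos, h.nonneg, h.sum_eq, h.le_first, fun j hj => by
    simp only [mul_neg, Finset.sum_neg_distrib, ← h.eq_sum j hj]⟩

theorem IsAveraging.le_sub (h : IsAveraging V β M N t) {j : ℕ} (hj : j < N) {c δ : ℝ} (hδ : 0 ≤ δ)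
    (hc : ∀ i < M, V (j + i + 1) ≤ c) (h1 : V (j + 1) ≤ c - δ) : V j ≤ c - t * δ := by
  have key : V j ≤ ∑ i ∈ range M, (β j i * c - if i = 0 then β j 0 * δ else 0) := by
    rw [h.eq_sum j hj]
    refine Finset.sum_le_sum fun i hi => ?_
    rcases Nat.eq_zero_or_pos i with rfl | hi0
    · have := mul_le_mul_of_nonneg_left h1 (h.nonneg j hj 0)
      simp only [add_zero, if_true]
      linarith
    · rw [if_neg hi0.ne', sub_zero]
      exact mul_le_mul_of_nonneg_left (hc i (Finset.mem_range.mp hi)) (h.nonneg j hj i)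
  rw [Finset.sum_sub_distrib, ← Finset.sum_mul, h.sum_eq j hj, Finset.sum_ite_eq' (range M) 0,
    if_pos (Finset.mem_range.mpr h.pos)] at key
  have := mul_le_mul_of_nonneg_right (h.le_first j hj) hδ
  linarith

theorem IsAveraging.le_of_window (h : IsAveraging V β M N t) {s : ℕ} (hs : s ≤ N) {c : ℝ}
    (hc : ∀ j, s ≤ j → j ≤ s + M → V j ≤ c) : ∀ j ≤ s + M, V j ≤ c := by
  have key : ∀ d ≤ s, ∀ j, s - d ≤ j → j ≤ s + M → V j ≤ c := by
    intro d
    induction d with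
    | zero => exact fun _ j => by simpa using hc j
    | succ d ih =>
      intro hd j hj1 hj2
      rcases Nat.lt_or_ge j (s - d) with hlt | hge
      · have := h.le_sub (j := j) (by omega) (c := c) le_rfl
          (fun i hi => ih (by omega) _ (by omega) (by omega))
          (by simpa using ih (by omega) (j + 1) (by omega) (by have := h.pos; omega))
        simpa using this
      · exact ih (by omega) j hge hj2
  exact fun j hj => key s le_rfl j (by simp) hj

/-- Each unit step back from `s + M` keeps at least a fraction `t` of the deficit. After `M` such
steps a full window lies below the new bound, and averaging carries that bound to all earlier
indices. -/
theorem IsAveraging.le_sub_pow (h : IsAveraging V β M N t) (ht0 : 0 ≤ t) (ht1 : t ≤ 1) {s : ℕ}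
    (hs : s + M ≤ N) {c δ : ℝ} (hδ : 0 ≤ δ) (hc : ∀ j ≤ s + M + M, V j ≤ c)
    (h1 : V (s + M) ≤ c - δ) : ∀ j ≤ s + M, V j ≤ c - t ^ M * δ := by
  have key : ∀ d ≤ M, V (s + M - d) ≤ c - t ^ d * δ := by
    intro d
    induction d with
    | zero => simpa using h1
    | succ d ih =>
      intro hd
      have e : s + M - (d + 1) + 1 = s + M - d := by omega
      have := h.le_sub (j := s + M - (d + 1)) (by omega) (c := c) (δ := t ^ d * δ) (by positivity)
        (fun i hi => hc _ (by omega)) (by rw [e]; exact ih (by omega))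
      rw [pow_succ']
      linarith
  refine h.le_of_window (by omega) fun j hj1 hj2 => ?_
  have := key (s + M - j) (by omega)
  rw [show s + M - (s + M - j) = j by omega] at this
  have hp : t ^ M ≤ t ^ (s + M - j) := pow_le_pow_of_le_one ht0 ht1 (by omega)
  nlinarith

theorem IsAveraging.exists_bounds (h : IsAveraging V β M N t) (ht0 : 0 ≤ t) (ht1 : t ≤ 1)
    (hV : ∀ j ≤ N + M, 0 ≤ V j ∧ V j ≤ 1) (k : ℕ) :
    ∀ s, s + k * M = N → ∃ lo hi : ℝ, hi - lo ≤ (1 - t ^ M / 2) ^ k ∧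
      ∀ j ≤ s + M, lo ≤ V j ∧ V j ≤ hi := by
  have htM0 : 0 ≤ t ^ M := pow_nonneg ht0 M
  have htM1 : t ^ M ≤ 1 := pow_le_one₀ ht0 ht1
  induction k with
  | zero =>
    intro s hs
    obtain rfl : s = N := by simpa using hs
    exact ⟨0, 1, by simp, hV⟩
  | succ k ih =>
    intro s hs
    obtain ⟨lo, hi, hd, hb⟩ := ih (s + M) (by rw [← hs]; ring)
    have hsN : s + M ≤ N := by rw [← hs]; nlinarith
    have hle : lo ≤ hi := (hb 0 (by omega)).1.trans (hb 0 (by omega)).2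
    have hfin : (hi - lo) * (1 - t ^ M / 2) ≤ (1 - t ^ M / 2) ^ (k + 1) := by
      rw [pow_succ]
      exact mul_le_mul_of_nonneg_right hd (by linarith)
    -- On whichever side of the midpoint this value lies, the opposite bound improves by `t ^ M`
    -- times half the oscillation; hence the factor `1 - t ^ M / 2`.
    rcases le_total (V (s + M)) ((hi + lo) / 2) with hm | hm
    · refine ⟨lo, hi - t ^ M * ((hi - lo) / 2), by linarith, fun j hj => ⟨(hb j (by omega)).1, ?_⟩⟩
      exact h.le_sub_pow ht0 ht1 hsN (by linarith) (fun i hi => (hb i hi).2) (by linarith) j hj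
    · refine ⟨lo + t ^ M * ((hi - lo) / 2), hi, by linarith, fun j hj => ⟨?_, (hb j (by omega)).2⟩⟩
      have := h.neg.le_sub_pow ht0 ht1 hsN (c := -lo) (δ := (hi - lo) / 2) (by linarith)
        (fun i hi => neg_le_neg (hb i hi).1) (by linarith) j hj
      linarith

theorem IsAveraging.abs_sub_le (h : IsAveraging V β M N t) (ht0 : 0 ≤ t) (ht1 : t ≤ 1)
    (hV : ∀ j ≤ N + M, 0 ≤ V j ∧ V j ≤ 1) : |V 0 - V 1| ≤ (1 - t ^ M / 2) ^ (N / M) := by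
  obtain ⟨lo, hi, hd, hb⟩ := h.exists_bounds ht0 ht1 hV (N / M) (N % M) (by
    rw [mul_comm]; exact Nat.mod_add_div N M)
  have hM := h.pos
  have h0 := hb 0 (by omega)
  have h1 := hb 1 (by omega)
  rw [abs_le]
  constructor <;> linarith

end Averaging

/-! ### Weights and decompositions of words -/

section Words

variable {W : Type*}

/-- The product weight of a word. -/
noncomputable def wordWeight (p : W → ℝ≥0∞) (l : List W) : ℝ≥0∞ := (l.map p).prod

theorem wordWeight_append (p : W → ℝ≥0∞) (k l : List W) :
    wordWeight p (k ++ l) = wordWeight p k * wordWeight p l := by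
  simp [wordWeight]

theorem wordWeight_nil (p : W → ℝ≥0∞) : wordWeight p [] = 1 := rfl

theorem wordWeight_cons (p : W → ℝ≥0∞) (w : W) (l : List W) :
    wordWeight p (w :: l) = p w * wordWeight p l := by
  simp [wordWeight]

theorem wordWeight_take_mul_drop (p : W → ℝ≥0∞) (l : List W) (i : ℕ) :
    wordWeight p (l.take i) * wordWeight p (l.drop i) = wordWeight p l := by
  rw [← wordWeight_append, List.take_append_drop]

theorem wordWeight_take_ne_zero {p : W → ℝ≥0∞} {l : List W} (h : wordWeight p l ≠ 0) (i : ℕ) :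
    wordWeight p (l.take i) ≠ 0 :=
  left_ne_zero_of_mul (wordWeight_take_mul_drop p l i ▸ h)

theorem wordWeight_drop_ne_zero {p : W → ℝ≥0∞} {l : List W} (h : wordWeight p l ≠ 0) (i : ℕ) :
    wordWeight p (l.drop i) ≠ 0 :=
  right_ne_zero_of_mul (wordWeight_take_mul_drop p l i ▸ h)

theorem tsum_list (G : List W → ℝ≥0∞) : ∑' l, G l = G [] + ∑' w, ∑' l, G (w :: l) := by
  let e : Unit ⊕ W × List W ≃ List W :=
    { toFun := Sum.elim (fun _ => []) fun q => q.1 :: q.2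
      invFun := fun l => match l with
        | [] => .inl ()
        | w :: l => .inr (w, l)
      left_inv := by rintro (_ | _) <;> rfl
      right_inv := by rintro (_ | _) <;> rfl }
  rw [← e.tsum_eq, Summable.tsum_sum ENNReal.summable ENNReal.summable, ← ENNReal.tsum_prod]
  simp [e]

theorem tsum_sum_splits (G : List W → List W → ℝ≥0∞) :
    ∑' l : List W, ∑ i ∈ range (l.length + 1), G (l.take i) (l.drop i) = ∑' k, ∑' l, G k l := by
  let e : (Σ l : List W, Fin (l.length + 1)) ≃ List W × List W :=
    { toFun := fun q => (q.1.take q.2, q.1.drop q.2)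
      invFun := fun q => ⟨q.1 ++ q.2, ⟨q.1.length, by simp⟩⟩
      left_inv := by
        rintro ⟨l, i, hi⟩
        have hl : min i l.length = i := by omega
        refine Sigma.ext (by simp) ?_
        rw [Fin.heq_ext_iff (by simp)]
        simpa using by omega
      right_inv := by rintro ⟨k, l⟩; simp }
  rw [← ENNReal.tsum_prod, ← e.tsum_eq, ENNReal.tsum_sigma']
  simp_rw [tsum_fintype, ← Fin.sum_univ_eq_sum_range (fun i => G (List.take i _) (List.drop i _))]
  rfl

/-! ### Stopping densities and optional stopping -/

/-- The conditional probabilities, given the word read so far, of stopping now, for a stopping rule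
which stops by the time `M`. -/
structure IsStoppingDensity (p : W → ℝ≥0∞) (a : List W → ℝ≥0) (M : ℕ) : Prop where
  sum_le : ∀ l, wordWeight p l ≠ 0 → ∑ i ∈ range (l.length + 1), a (l.take i) ≤ 1
  sum_eq : ∀ l, wordWeight p l ≠ 0 → M ≤ l.length →
    ∑ i ∈ range (l.length + 1), a (l.take i) = 1

variable {p : W → ℝ≥0∞} {a : List W → ℝ≥0} {M : ℕ}

theorem IsStoppingDensity.mono (h : IsStoppingDensity p a M) {M' : ℕ} (hM : M ≤ M') :
    IsStoppingDensity p a M' :=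
  ⟨h.sum_le, fun l h0 hl => h.sum_eq l h0 (hM.trans hl)⟩

theorem IsStoppingDensity.sum_window (h : IsStoppingDensity p a M) {l : List W}
    (h0 : wordWeight p l ≠ 0) (hl : M ≤ l.length) : ∑ i ∈ range (M + 1), a (l.take i) = 1 := by
  have := h.sum_eq (l.take M) (wordWeight_take_ne_zero h0 M) (by simp; omega)
  rw [← this, List.length_take, min_eq_left hl]
  refine Finset.sum_congr rfl fun i hi => ?_
  rw [List.take_take, min_eq_left (by simp at hi; omega)]

/-- The prefixes of length at most `M` already use up the total mass 1. -/
theorem IsStoppingDensity.eq_zero (h : IsStoppingDensity p a M) {l : List W}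
    (h0 : wordWeight p l ≠ 0) (hl : M < l.length) : a l = 0 := by
  have h1 := h.sum_window h0 hl.le
  have h2 := h.sum_le l h0
  rw [Finset.sum_range_succ, List.take_length] at h2
  have h3 : ∑ i ∈ range (M + 1), a (l.take i) ≤ ∑ i ∈ range l.length, a (l.take i) :=
    Finset.sum_le_sum_of_subset (Finset.range_mono hl)
  rw [h1] at h3
  exact le_antisymm (by simpa using (add_le_add_left h3 (a l)).trans h2) (zero_le)

/-- Optional stopping by induction on the first letter. The total mass `S` is left free because
after one letter the density only has mass `S - a []` left to spend. -/
theorem tsum_stopped_of_harmonic (hp : ∑' w, p w = 1) (F : List W → ℝ≥0∞)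
    (hF : ∀ g, ∑' w, p w * F (g ++ [w]) = F g) (M : ℕ) : ∀ (a : List W → ℝ≥0) (S : ℝ≥0)
    (_ : ∀ l : List W, wordWeight p l ≠ 0 → l.length = M →
      ∑ i ∈ range (M + 1), a (l.take i) = S)
    (_ : ∀ l : List W, wordWeight p l ≠ 0 → M < l.length → a l = 0) (g : List W),
    ∑' l, wordWeight p l * a l * F (g ++ l) = S * F g := by
  obtain ⟨w₀, hw₀⟩ : ∃ w, p w ≠ 0 := by
    by_contra! h
    simp [h] at hp
  induction M with
  | zero =>
    intro a S hS ha g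
    rw [tsum_eq_single [] fun l hl => ?_]
    · have := hS [] (by simp [wordWeight]) rfl
      simp at this
      simp [wordWeight_nil, this]
    · by_cases h0 : wordWeight p l = 0
      · simp [h0]
      · simp [ha l h0 (List.length_pos_iff.mpr hl)]
  | succ M ih =>
    intro a S hS ha g
    have haS : a [] ≤ S := by
      -- One full-length word of positive weight is needed to see that `S - a []` is not truncated.
      rw [← hS (List.replicate (M + 1) w₀) (by simp [wordWeight, hw₀]) (by simp)]
      exact Finset.single_le_sum (f := fun i => a ((List.replicate (M + 1) w₀).take i))
        (fun _ _ => zero_le) (Finset.mem_range.mpr (Nat.succ_pos _))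
    have key : ∀ w, ∑' l, wordWeight p (w :: l) * a (w :: l) * F (g ++ w :: l) =
        (S - a [] : ℝ≥0) * (p w * F (g ++ [w])) := by
      intro w
      by_cases hw : p w = 0
      · simp [wordWeight_cons, hw]
      have := ih (fun l => a (w :: l)) (S - a [])
        (fun l h0 hl => by
          have := hS (w :: l) (by simp [wordWeight_cons, hw, h0]) (by simp [hl])
          rw [Finset.sum_range_succ'] at this
          simp only [List.take_succ_cons, List.take_zero] at this
          rw [← this, add_tsub_cancel_right])
        (fun l h0 hl => ha _ (by simp [wordWeight_cons, hw, h0]) (by simpa using hl)) (g ++ [w])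
      rw [mul_left_comm, ← this, ← ENNReal.tsum_mul_left]
      refine tsum_congr fun l => ?_
      rw [wordWeight_cons, List.append_assoc]
      simp only [List.singleton_append, mul_assoc]
    rw [tsum_list]
    simp_rw [key]
    rw [ENNReal.tsum_mul_left, hF, wordWeight_nil, one_mul, List.append_nil, ← add_mul,
      ← ENNReal.coe_add, add_tsub_cancel_of_le haS]

/-! ### First entry into long words -/

/-- The probability that the walk on words with jump densities `β` first reaches the words of
length at least `n` at the word `l`, relative to the weight of `l`. -/
noncomputable def firstEntry (β : List W → ℝ≥0) : ℕ → List W → ℝ≥0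
  | 0, [] => 1
  | 0, _ :: _ => 0
  | n + 1, l => ∑ i ∈ range l.length, β (l.take (i + 1)) * firstEntry β (n - i) (l.drop (i + 1))
termination_by n => n
decreasing_by omega

variable {β : List W → ℝ≥0}

theorem firstEntry_zero_of_ne_nil {l : List W} (hl : l ≠ []) : firstEntry β 0 l = 0 := by
  cases l with
  | nil => exact absurd rfl hl
  | cons => rw [firstEntry]

theorem firstEntry_succ (n : ℕ) (l : List W) : firstEntry β (n + 1) l =
    ∑ i ∈ range l.length, β (l.take (i + 1)) * firstEntry β (n - i) (l.drop (i + 1)) := by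
  rw [firstEntry]

theorem firstEntry_succ_eq_sum_splits (hβ : β [] = 0) (n : ℕ) (l : List W) :
    firstEntry β (n + 1) l =
      ∑ i ∈ range (l.length + 1), β (l.take i) * firstEntry β (n + 1 - i) (l.drop i) := by
  rw [firstEntry_succ, Finset.sum_range_succ']
  simp [hβ]

theorem IsStoppingDensity.sum_succ_le (h : IsStoppingDensity p β M) {l : List W}
    (h0 : wordWeight p l ≠ 0) : ∑ i ∈ range l.length, β (l.take (i + 1)) ≤ 1 := by
  have := h.sum_le l h0
  rw [Finset.sum_range_succ'] at this
  exact le_self_add.trans this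

theorem IsStoppingDensity.sum_succ_eq (h : IsStoppingDensity p β M) (hβ : β [] = 0) {l : List W}
    (h0 : wordWeight p l ≠ 0) (hl : M ≤ l.length) :
    ∑ i ∈ range l.length, β (l.take (i + 1)) = 1 := by
  have := h.sum_eq l h0 hl
  rw [Finset.sum_range_succ'] at this
  simpa [hβ] using this

theorem IsStoppingDensity.firstEntry_le_one (h : IsStoppingDensity p β M) (n : ℕ) :
    ∀ l, wordWeight p l ≠ 0 → firstEntry β n l ≤ 1 := by
  induction n using Nat.strong_induction_on with
  | _ n ih =>
    intro l h0
    match n, l with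
    | 0, [] => simp [firstEntry]
    | 0, _ :: _ => simp [firstEntry]
    | n + 1, l =>
      rw [firstEntry_succ]
      refine le_trans (Finset.sum_le_sum fun i _ => ?_) (h.sum_succ_le h0)
      exact mul_le_of_le_one_right' (ih _ (by omega) _ (wordWeight_drop_ne_zero h0 _))

theorem firstEntry_eq_zero_of_length_lt (n : ℕ) :
    ∀ l : List W, l.length < n → firstEntry β n l = 0 := by
  induction n using Nat.strong_induction_on with
  | _ n ih =>
    intro l hl
    match n with
    | 0 => omega
    | n + 1 =>
      rw [firstEntry_succ]
      refine Finset.sum_eq_zero fun i hi => ?_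
      have := Finset.mem_range.mp hi
      rw [ih (n - i) (by omega) _ (by simp; omega), mul_zero]

theorem IsStoppingDensity.firstEntry_eq_zero (h : IsStoppingDensity p β M) (n : ℕ) :
    ∀ l : List W, wordWeight p l ≠ 0 → n + M < l.length → firstEntry β n l = 0 := by
  induction n using Nat.strong_induction_on with
  | _ n ih =>
    intro l h0 hl
    match n with
    | 0 => exact firstEntry_zero_of_ne_nil (by rintro rfl; simp at hl)
    | n + 1 =>
      rw [firstEntry_succ]
      refine Finset.sum_eq_zero fun i hi => ?_
      have := Finset.mem_range.mp hi
      rcases Nat.lt_or_ge M (i + 1) with hM | hM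
      · rw [h.eq_zero (wordWeight_take_ne_zero h0 _) (by simp; omega), zero_mul]
      -- A jump past the level leaves level 0 by truncated subtraction, and entry at level 0 allows
      -- no remaining letters.
      rcases Nat.lt_or_ge n i with hn | hn
      · rw [Nat.sub_eq_zero_of_le hn.le, firstEntry_zero_of_ne_nil, mul_zero]
        rw [← List.length_pos_iff]
        simp; omega
      · rw [ih (n - i) (by omega) _ (wordWeight_drop_ne_zero h0 _) (by simp; omega), mul_zero]

theorem pow_le_firstEntry {t : ℝ≥0} (ht : ∀ w, p w ≠ 0 → t ≤ β [w]) :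
    ∀ l : List W, wordWeight p l ≠ 0 → t ^ l.length ≤ firstEntry β l.length l := by
  intro l
  induction l with
  | nil => simp [firstEntry]
  | cons w l ih =>
    intro h0
    rw [wordWeight_cons] at h0
    rw [List.length_cons, firstEntry_succ, pow_succ']
    refine le_trans ?_ (Finset.single_le_sum (fun _ _ => zero_le)
      (Finset.mem_range.mpr (Nat.succ_pos l.length)))
    simpa using mul_le_mul' (ht w (left_ne_zero_of_mul h0)) (ih (right_ne_zero_of_mul h0))

/-- Up to length `M`, unit jumps alone suffice. Beyond it, the first jump averages bounds for
shorter words with total weight 1, so nothing is lost as `n` grows. -/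
theorem IsStoppingDensity.pow_le_firstEntry (h : IsStoppingDensity p β M) (hβ : β [] = 0)
    {t : ℝ≥0} (ht1 : t ≤ 1) (ht : ∀ w, p w ≠ 0 → t ≤ β [w]) (n : ℕ) :
    ∀ l : List W, wordWeight p l ≠ 0 → l.length = n → t ^ M ≤ firstEntry β n l := by
  induction n using Nat.strong_induction_on with
  | _ n ih =>
    intro l h0 hl
    rcases le_total n M with hn | hn
    · subst hl
      exact (pow_le_pow_of_le_one zero_le ht1 hn).trans (RandomWalk.pow_le_firstEntry ht l h0)
    match n with
    | 0 =>
      obtain rfl := List.length_eq_zero_iff.mp hl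
      rw [firstEntry]
      exact pow_le_one₀ zero_le ht1
    | n + 1 =>
      rw [firstEntry_succ]
      calc t ^ M = ∑ i ∈ range l.length, β (l.take (i + 1)) * t ^ M := by
            rw [← Finset.sum_mul, h.sum_succ_eq hβ h0 (hl ▸ hn), one_mul]
        _ ≤ _ := Finset.sum_le_sum fun i hi => by
            have := Finset.mem_range.mp hi
            gcongr
            exact ih (n - i) (by omega) _ (wordWeight_drop_ne_zero h0 _) (by simp; omega)

/-- Freezing the word turns the jump walk into a chain on its positions; conditioning on the first
jump is the averaging. Before `n - M` at least `M` letters remain, so the jump weights sum to 1. -/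
theorem IsStoppingDensity.isAveraging (h : IsStoppingDensity p β M) (hβ : β [] = 0) (hM : 0 < M)
    {t : ℝ≥0} (ht : ∀ w, p w ≠ 0 → t ≤ β [w]) {l : List W} (h0 : wordWeight p l ≠ 0) {n : ℕ}
    (hn : n ≤ l.length) :
    IsAveraging (fun j => (firstEntry β (n - j) (l.drop j) : ℝ))
      (fun j i => (β ((l.drop j).take (i + 1)) : ℝ)) M (n - M) t where
  pos := hM
  nonneg _ _ _ := NNReal.coe_nonneg _
  sum_eq j hj := by
    have := h.sum_window (wordWeight_drop_ne_zero h0 j) (by simp; omega)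
    rw [Finset.sum_range_succ'] at this
    simp only [List.take_zero, hβ, add_zero] at this
    exact_mod_cast this
  le_first j hj := by
    have hd : l.drop j = l[j] :: l.drop (j + 1) := List.drop_eq_getElem_cons (by omega)
    have h1 := wordWeight_drop_ne_zero h0 j
    rw [hd, wordWeight_cons] at h1
    rw [hd]
    exact NNReal.coe_le_coe.mpr (ht _ (left_ne_zero_of_mul h1))
  eq_sum j hj := by
    obtain ⟨m, hm⟩ : ∃ m, n - j = m + 1 := ⟨n - j - 1, by omega⟩
    rw [hm, firstEntry_succ]
    push_cast
    have hsub : range M ⊆ range (l.drop j).length := Finset.range_mono (by simp; omega)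
    rw [← Finset.sum_subset hsub fun i hi hiM => ?_]
    · refine Finset.sum_congr rfl fun i _ => ?_
      rw [List.drop_drop, show m - i = n - (j + i + 1) by omega, add_assoc]
    · have h1 := Finset.mem_range.mp hi
      have h2 : M ≤ i := by simpa using hiM
      rw [h.eq_zero (wordWeight_take_ne_zero (wordWeight_drop_ne_zero h0 j) _)
        (by simp at h1 ⊢; omega)]
      simp

theorem IsStoppingDensity.abs_firstEntry_sub_le (h : IsStoppingDensity p β M) (hβ : β [] = 0)
    (hM : 0 < M) {t : ℝ≥0} (ht1 : t ≤ 1) (ht : ∀ w, p w ≠ 0 → t ≤ β [w]) {w : W} {l : List W}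
    (h0 : wordWeight p (w :: l) ≠ 0) {n : ℕ} (hn : n ≤ l.length) :
    |(firstEntry β (n + 1) (w :: l) : ℝ) - firstEntry β n l| ≤
      (1 - (t : ℝ) ^ M / 2) ^ ((n + 1 - M) / M) := by
  have := (h.isAveraging hβ hM ht h0 (n := n + 1) (by simpa using hn)).abs_sub_le
    t.coe_nonneg (by exact_mod_cast ht1) (fun j _ => ⟨NNReal.coe_nonneg _, by
      exact_mod_cast h.firstEntry_le_one _ _ (wordWeight_drop_ne_zero h0 j)⟩)
  simpa using this

/-- Condition on the first jump; `β [] = 0` forces it to lower the level, so strong induction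
applies. -/
theorem tsum_firstEntry (hβ : β [] = 0) {F : List W → ℝ≥0∞}
    (hF : ∀ g, ∑' l, wordWeight p l * β l * F (g ++ l) = F g) (n : ℕ) :
    ∀ g, ∑' l, wordWeight p l * firstEntry β n l * F (g ++ l) = F g := by
  induction n using Nat.strong_induction_on with
  | _ n ih =>
    intro g
    match n with
    | 0 =>
      rw [tsum_eq_single [] fun l hl => by simp [firstEntry_zero_of_ne_nil hl]]
      simp [wordWeight_nil, firstEntry]
    | n + 1 =>
      let G : List W → List W → ℝ≥0∞ := fun k l => wordWeight p k * β k *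
        (wordWeight p l * firstEntry β (n + 1 - k.length) l * F (g ++ k ++ l))
      have key : ∀ l, wordWeight p l * firstEntry β (n + 1) l * F (g ++ l) =
          ∑ i ∈ range (l.length + 1), G (l.take i) (l.drop i) := by
        intro l
        rw [firstEntry_succ_eq_sum_splits hβ]
        push_cast
        rw [Finset.mul_sum, Finset.sum_mul]
        refine Finset.sum_congr rfl fun i hi => ?_
        have : i ≤ l.length := by simpa [Nat.lt_succ_iff] using hi
        simp only [G, List.append_assoc, List.take_append_drop, List.length_take, min_eq_left this]
        rw [← wordWeight_take_mul_drop p l i]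
        ring
      refine (tsum_congr key).trans ((tsum_sum_splits G).trans ?_)
      conv_rhs => rw [← hF g]
      refine tsum_congr fun k => ?_
      rw [ENNReal.tsum_mul_left]
      rcases eq_or_ne k [] with rfl | hk
      · simp [hβ]
      · have := List.length_pos_iff.mpr hk
        rw [ih (n + 1 - k.length) (by omega)]

theorem IsStoppingDensity.pow_mul_tsum_length_eq_le (h : IsStoppingDensity p β M) (hβ : β [] = 0)
    {t : ℝ≥0} (ht1 : t ≤ 1) (ht : ∀ w, p w ≠ 0 → t ≤ β [w]) {F : List W → ℝ≥0∞}
    (hF : ∀ g, ∑' l, wordWeight p l * β l * F (g ++ l) = F g) (n : ℕ) (g : List W) :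
    (t : ℝ≥0∞) ^ M * ∑' l, (if l.length = n then wordWeight p l * F (g ++ l) else 0) ≤ F g := by
  rw [← ENNReal.tsum_mul_left]
  conv_rhs => rw [← tsum_firstEntry hβ hF n g]
  refine ENNReal.tsum_le_tsum fun l => ?_
  split_ifs with hl
  · by_cases h0 : wordWeight p l = 0
    · simp [h0]
    have : (t : ℝ≥0∞) ^ M ≤ firstEntry β n l := by
      exact_mod_cast h.pow_le_firstEntry hβ ht1 ht n l h0 hl
    calc _ = wordWeight p l * (t : ℝ≥0∞) ^ M * F (g ++ l) := by ring
      _ ≤ _ := by gcongr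
  · simp

theorem IsStoppingDensity.pow_mul_tsum_window_le (h : IsStoppingDensity p β M) (hβ : β [] = 0)
    {t : ℝ≥0} (ht1 : t ≤ 1) (ht : ∀ w, p w ≠ 0 → t ≤ β [w]) {F : List W → ℝ≥0∞}
    (hF : ∀ g, ∑' l, wordWeight p l * β l * F (g ++ l) = F g) (n : ℕ) (g : List W) :
    (t : ℝ≥0∞) ^ M * ∑' l : List W, (if n ≤ l.length ∧ l.length ≤ n + M then
      wordWeight p l * F (g ++ l) else 0) ≤ (M + 1 : ℕ) * F g := by
  have key : ∀ l : List W, (if n ≤ l.length ∧ l.length ≤ n + M then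
      wordWeight p l * F (g ++ l) else 0) =
      ∑ j ∈ range (M + 1), if l.length = n + j then wordWeight p l * F (g ++ l) else 0 := by
    intro l
    split_ifs with hl
    · rw [Finset.sum_eq_single (l.length - n)]
      · rw [if_pos (by omega)]
      · intro j _ hj
        rw [if_neg (by omega)]
      · intro hn
        simp at hn
        omega
    · refine (Finset.sum_eq_zero fun j hj => if_neg ?_).symm
      have := Finset.mem_range.mp hj
      omega
  simp_rw [key]
  rw [Summable.tsum_finsetSum fun _ _ => ENNReal.summable, Finset.mul_sum]
  refine (Finset.sum_le_sum fun j _ =>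
    h.pow_mul_tsum_length_eq_le hβ ht1 ht hF (n + j) g).trans ?_
  simp

theorem IsStoppingDensity.harmonic_of_tsum (h : IsStoppingDensity p β M)
    (hβ : β [] = 0) (hM : 0 < M) {t : ℝ≥0} (ht0 : 0 < t) (ht1 : t ≤ 1)
    (ht : ∀ w, p w ≠ 0 → t ≤ β [w]) {F : List W → ℝ≥0∞} (hFtop : ∀ g, F g ≠ ∞)
    (hF : ∀ g, ∑' l, wordWeight p l * β l * F (g ++ l) = F g) (g : List W) :
    ∑' w, p w * F (g ++ [w]) = F g := by
  -- `ε n` bounds the gap between the two entry coefficients; `C` bounds the `F`-mass of the `M + 1`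
  -- lengths on which they can be nonzero.
  set ε : ℕ → ℝ≥0 := fun n => (1 - t ^ M / 2) ^ ((n + 1 - M) / M) with hε
  set C : ℝ≥0∞ := (M + 1 : ℕ) * F g / (t : ℝ≥0∞) ^ M with hC
  have htM : (t : ℝ≥0∞) ^ M ≠ 0 := pow_ne_zero _ (by exact_mod_cast ht0.ne')
  have hCtop : C ≠ ∞ := ENNReal.div_ne_top (ENNReal.mul_ne_top (by simp) (hFtop g)) htM
  have hεC : ∀ n : ℕ, ∑' w, ∑' l, (ε n : ℝ≥0∞) * (if n + 1 ≤ (w :: l).length ∧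
      (w :: l).length ≤ n + 1 + M then wordWeight p (w :: l) * F (g ++ w :: l) else 0) ≤
      ε n * C := by
    intro n
    simp_rw [ENNReal.tsum_mul_left]
    gcongr
    rw [hC, ENNReal.le_div_iff_mul_le (.inl htM) (.inl (by finiteness)), mul_comm]
    refine le_trans ?_ (h.pow_mul_tsum_window_le hβ ht1 ht hF (n + 1) g)
    gcongr
    conv_rhs => rw [tsum_list]
    exact le_add_self
  have hA : ∀ n, F g =
      ∑' w, ∑' l, wordWeight p (w :: l) * firstEntry β (n + 1) (w :: l) * F (g ++ w :: l) := by
    intro n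
    conv_lhs => rw [← tsum_firstEntry hβ hF (n + 1) g, tsum_list]
    simp [firstEntry_succ]
  have hB : ∀ n, ∑' w, p w * F (g ++ [w]) =
      ∑' w, ∑' l, wordWeight p (w :: l) * firstEntry β n l * F (g ++ w :: l) := by
    intro n
    refine tsum_congr fun w => ?_
    rw [← tsum_firstEntry hβ hF n (g ++ [w]), ← ENNReal.tsum_mul_left]
    refine tsum_congr fun l => ?_
    rw [wordWeight_cons, List.append_assoc, List.singleton_append]
    ring
  have hdiff : ∀ n w l, wordWeight p (w :: l) ≠ 0 → n ≤ l.length →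
      firstEntry β (n + 1) (w :: l) ≤ firstEntry β n l + ε n ∧
      firstEntry β n l ≤ firstEntry β (n + 1) (w :: l) + ε n := by
    intro n w l h0 hl
    have key := h.abs_firstEntry_sub_le hβ hM ht1 ht h0 hl
    have hle : t ^ M / 2 ≤ 1 := by
      have : t ^ M ≤ 1 := pow_le_one₀ zero_le ht1
      exact (half_le_self zero_le).trans this
    rw [show (1 - (t : ℝ) ^ M / 2) ^ ((n + 1 - M) / M) = (ε n : ℝ) by
      simp only [hε, NNReal.coe_pow, NNReal.coe_sub hle]; simp, abs_le] at key
    constructor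
    · rw [← NNReal.coe_le_coe]; push_cast; linarith
    · rw [← NNReal.coe_le_coe]; push_cast; linarith
  -- Outside the window of lengths the coefficient `x` vanishes, so the error term is needed only
  -- inside it.
  have hcmp : ∀ n w l (x y : ℝ≥0), (wordWeight p (w :: l) ≠ 0 → n ≤ l.length → x ≤ y + ε n) →
      (wordWeight p (w :: l) ≠ 0 → l.length < n → x = 0) →
      (wordWeight p (w :: l) ≠ 0 → n + 1 + M < (w :: l).length → x = 0) →
      wordWeight p (w :: l) * x * F (g ++ w :: l) ≤
      wordWeight p (w :: l) * y * F (g ++ w :: l) + (ε n : ℝ≥0∞) * (if n + 1 ≤ (w :: l).length ∧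
      (w :: l).length ≤ n + 1 + M then wordWeight p (w :: l) * F (g ++ w :: l) else 0) := by
    intro n w l x y h1 h2 h3
    by_cases h0 : wordWeight p (w :: l) = 0
    · simp [h0]
    rcases Nat.lt_or_ge l.length n with hl | hl
    · simp [h2 h0 hl]
    rcases Nat.lt_or_ge (n + 1 + M) (w :: l).length with hl' | hl'
    · simp [h3 h0 hl']
    rw [if_pos ⟨by simpa using hl, hl'⟩]
    have : (x : ℝ≥0∞) ≤ y + ε n := by exact_mod_cast h1 h0 hl
    calc _ ≤ wordWeight p (w :: l) * (y + ε n : ℝ≥0∞) * F (g ++ w :: l) := by gcongr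
      _ = _ := by ring
  have hsum : ∀ n (x y : W → List W → ℝ≥0∞), (∀ w l, x w l ≤ y w l +
      (ε n : ℝ≥0∞) * (if n + 1 ≤ (w :: l).length ∧ (w :: l).length ≤ n + 1 + M then
        wordWeight p (w :: l) * F (g ++ w :: l) else 0)) →
      ∑' w, ∑' l, x w l ≤ ∑' w, ∑' l, y w l + ε n * C := by
    intro n x y hxy
    calc _ ≤ _ := ENNReal.tsum_le_tsum fun w => ENNReal.tsum_le_tsum fun l => hxy w l
      _ ≤ _ := by
        simp_rw [ENNReal.tsum_add]
        gcongr
        exact hεC n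
  have h0 : ∀ n w l, wordWeight p (w :: l) ≠ 0 → n + 1 + M < (w :: l).length →
      firstEntry β n l = 0 := fun n w l h0 hl =>
    h.firstEntry_eq_zero n l (right_ne_zero_of_mul (wordWeight_cons p w l ▸ h0))
      (by simp at hl; omega)
  have hle : ∀ n, ∑' w, p w * F (g ++ [w]) ≤ F g + ε n * C := by
    intro n
    rw [hB n]
    conv_rhs => rw [hA n]
    exact hsum n _ _ fun w l => hcmp n w l _ _ (fun h0 hl => (hdiff n w l h0 hl).2)
      (fun _ hl => firstEntry_eq_zero_of_length_lt n l hl) (h0 n w l)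
  have hge : ∀ n, F g ≤ ∑' w, p w * F (g ++ [w]) + ε n * C := by
    intro n
    rw [hB n]
    conv_lhs => rw [hA n]
    exact hsum n _ _ fun w l => hcmp n w l _ _ (fun h0 hl => (hdiff n w l h0 hl).1)
      (fun _ hl => firstEntry_eq_zero_of_length_lt _ _ (by simpa using hl))
      (fun h0 hl => h.firstEntry_eq_zero _ _ h0 hl)
  have hlim : Filter.Tendsto (fun n => (ε n : ℝ≥0∞) * C) Filter.atTop (nhds 0) := by
    have h1 : Filter.Tendsto ε Filter.atTop (nhds 0) := by
      refine (NNReal.tendsto_pow_atTop_nhds_zero_of_lt_one (r := 1 - t ^ M / 2) ?_).comp ?_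
      · exact tsub_lt_self one_pos (by positivity)
      · exact (Nat.tendsto_div_const_atTop hM.ne').comp
          ((Filter.tendsto_sub_atTop_nat M).comp (Filter.tendsto_add_atTop_nat 1))
    have h2 : Filter.Tendsto (fun n => (ε n : ℝ≥0∞)) Filter.atTop (nhds 0) := by
      rw [← ENNReal.coe_zero]
      exact ENNReal.tendsto_coe.mpr h1
    simpa using ENNReal.Tendsto.mul_const h2 (.inr hCtop)
  have hlim' : ∀ c, Filter.Tendsto (fun n => c + (ε n : ℝ≥0∞) * C) Filter.atTop (nhds c) :=
    fun c => by simpa using hlim.const_add c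
  exact le_antisymm (ge_of_tendsto' (hlim' _) hle) (ge_of_tendsto' (hlim' _) hge)

/-! ### The mixture and the removal of its trivial jumps -/

/-- The density of the mixture of one step of the walk with the stopped walk. -/
noncomputable def mixedDensity (t : ℝ≥0) (a : List W → ℝ≥0) (l : List W) : ℝ≥0 :=
  (if l.length = 1 then t else 0) + (1 - t) * a l

theorem IsStoppingDensity.mixedDensity (h : IsStoppingDensity p a M) (hM : 0 < M) {t : ℝ≥0}
    (ht1 : t ≤ 1) : IsStoppingDensity p (mixedDensity t a) M := by
  have key : ∀ l : List W, ∑ i ∈ range (l.length + 1), RandomWalk.mixedDensity t a (l.take i) =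
      (if 0 < l.length then t else 0) +
        (1 - t) * ∑ i ∈ range (l.length + 1), a (l.take i) := by
    intro l
    simp only [RandomWalk.mixedDensity]
    rw [Finset.sum_add_distrib, Finset.mul_sum]
    congr 1
    split_ifs with hl
    · rw [Finset.sum_eq_single 1]
      · rw [if_pos (by rw [List.length_take]; omega)]
      · intro i hi hi1
        simp at hi
        rw [if_neg (by simp; omega)]
      · intro hn
        exact absurd (Finset.mem_range.mpr (by omega)) hn
    · refine Finset.sum_eq_zero fun i _ => if_neg ?_
      simp; omega
  constructor
  · intro l h0
    rw [key]
    calc _ ≤ t + (1 - t) * 1 := by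
          gcongr
          · split_ifs <;> simp
          · exact h.sum_le l h0
      _ = 1 := by rw [mul_one, add_tsub_cancel_of_le ht1]
  · intro l h0 hl
    rw [key, h.sum_eq l h0 hl, if_pos (by omega), mul_one, add_tsub_cancel_of_le ht1]

/-- The density of the jumps of the walk with jump density `b` that move it. -/
noncomputable def jumpDensity (b : List W → ℝ≥0) (l : List W) : ℝ≥0 :=
  if l = [] then 0 else b l / (1 - b [])

theorem sum_jumpDensity (b : List W → ℝ≥0) (l : List W) :
    ∑ i ∈ range (l.length + 1), jumpDensity b (l.take i) =
      (∑ i ∈ range (l.length + 1), b (l.take i) - b []) / (1 - b []) := by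
  rw [Finset.sum_range_succ', Finset.sum_range_succ']
  simp only [List.take_zero, add_tsub_cancel_right, Finset.sum_div]
  simp only [jumpDensity, if_true, add_zero]
  refine Finset.sum_congr rfl fun i hi => if_neg ?_
  have := Finset.mem_range.mp hi
  rw [← List.length_eq_zero_iff, List.length_take]
  omega

theorem IsStoppingDensity.jumpDensity {b : List W → ℝ≥0} (h : IsStoppingDensity p b M)
    (hb : b [] < 1) : IsStoppingDensity p (jumpDensity b) M := by
  constructor
  · intro l h0
    rw [sum_jumpDensity]
    exact div_le_one_of_le₀ (tsub_le_tsub_right (h.sum_le l h0) _) zero_le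
  · intro l h0 hl
    rw [sum_jumpDensity, h.sum_eq l h0 hl, div_self (tsub_pos_of_lt hb).ne']

/-- Cancel the contribution `b [] * F g` of the empty jump, which is legitimate because `F g` is
finite, and divide by `1 - b []`. -/
theorem tsum_jumpDensity {b : List W → ℝ≥0} (hb : b [] < 1) {F : List W → ℝ≥0∞}
    (hFtop : ∀ g, F g ≠ ∞) (hF : ∀ g, ∑' l, wordWeight p l * b l * F (g ++ l) = F g)
    (g : List W) : ∑' l, wordWeight p l * jumpDensity b l * F (g ++ l) = F g := by
  have hne : 1 - b [] ≠ 0 := (tsub_pos_of_lt hb).ne'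
  have h1 := hF g
  rw [tsum_list] at h1 ⊢
  simp only [wordWeight_nil, one_mul, List.append_nil, jumpDensity, if_true, ENNReal.coe_zero,
    zero_mul, zero_add, reduceCtorEq, if_false] at h1 ⊢
  have h2 : ∑' w, ∑' l, wordWeight p (w :: l) * b (w :: l) * F (g ++ w :: l) =
      (1 - b [] : ℝ≥0) * F g := by
    have h3 : (b [] : ℝ≥0∞) * F g + (1 - b [] : ℝ≥0) * F g = F g := by
      rw [← add_mul, ← ENNReal.coe_add, add_tsub_cancel_of_le hb.le, ENNReal.coe_one, one_mul]
    exact (ENNReal.add_right_inj (ENNReal.mul_ne_top ENNReal.coe_ne_top (hFtop g))).mp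
      (h1.trans h3.symm)
  simp_rw [ENNReal.coe_div hne]
  have h4 : ∀ w l, wordWeight p (w :: l) * ((b (w :: l) : ℝ≥0∞) / (1 - b [] : ℝ≥0)) *
      F (g ++ w :: l) =
      ((1 - b [] : ℝ≥0) : ℝ≥0∞)⁻¹ * (wordWeight p (w :: l) * b (w :: l) * F (g ++ w :: l)) := by
    intro w l
    rw [div_eq_mul_inv]
    ring
  simp_rw [h4, ENNReal.tsum_mul_left]
  rw [h2, ← mul_assoc, ENNReal.inv_mul_cancel (by exact_mod_cast hne) ENNReal.coe_ne_top, one_mul]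

theorem IsStoppingDensity.harmonic_iff (h : IsStoppingDensity p a M) (hp : ∑' w, p w = 1)
    {t : ℝ≥0} (ht0 : 0 < t) (ht1 : t ≤ 1) {F : List W → ℝ≥0∞} (hFtop : ∀ g, F g ≠ ∞) :
    (∀ g, ∑' w, p w * F (g ++ [w]) = F g) ↔
      ∀ g, ∑' l, wordWeight p l * RandomWalk.mixedDensity t a l * F (g ++ l) = F g := by
  -- The range is raised to `M + 1` because `M` may be 0 while the mixture contains jumps of length
  -- 1.
  have hb := (h.mono M.le_succ).mixedDensity M.succ_pos ht1
  constructor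
  · intro hF g
    rw [tsum_stopped_of_harmonic hp F hF (M + 1) _ 1
      (fun l h0 hl => hb.sum_window h0 hl.ge) (fun l h0 hl => hb.eq_zero h0 hl)]
    simp
  · intro hF
    have ha0 : a [] ≤ 1 := by simpa using h.sum_le [] (by simp [wordWeight])
    have hb0 : RandomWalk.mixedDensity t a [] < 1 := by
      simp only [RandomWalk.mixedDensity, List.length_nil, zero_ne_one, if_false, zero_add]
      exact (mul_le_of_le_one_right' ha0).trans_lt (tsub_lt_self one_pos ht0)
    refine (hb.jumpDensity hb0).harmonic_of_tsum (by simp [RandomWalk.jumpDensity])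
      M.succ_pos ht0 ht1 (fun w _ => ?_) hFtop (tsum_jumpDensity hb0 hFtop hF)
    simp only [RandomWalk.jumpDensity, reduceCtorEq, if_false]
    rw [le_div_iff₀ (tsub_pos_of_lt hb0)]
    calc t * (1 - RandomWalk.mixedDensity t a []) ≤ t := mul_le_of_le_one_right' tsub_le_self
      _ ≤ _ := by simp [RandomWalk.mixedDensity]

end Words

/-- For nonnegative functions, an extended sum with a finite value already gives absolute
convergence. -/
theorem isHarmonic_iff {Γ : Type*} [Monoid Γ] [MeasurableSpace Γ] (ν : Measure Γ)
    [IsFiniteMeasure ν] {f : Γ → ℝ} (hf : ∀ g, 0 ≤ f g) :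
    IsHarmonic ν f ↔ ∀ g, ∑' h, ν {h} * ENNReal.ofReal (f (g * h)) = ENNReal.ofReal (f g) := by
  refine forall_congr' fun g => ?_
  have hnn : ∀ h, 0 ≤ f (g * h) * ν.real {h} := fun h => mul_nonneg (hf _) measureReal_nonneg
  have hterm : ∀ h, ν {h} * ENNReal.ofReal (f (g * h)) =
      ENNReal.ofReal (f (g * h) * ν.real {h}) := fun h => by
    rw [ENNReal.ofReal_mul (hf _), ofReal_measureReal, mul_comm]
  simp_rw [abs_of_nonneg (hnn _), hterm]
  constructor
  · rintro ⟨hs, he⟩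
    rw [← ENNReal.ofReal_tsum_of_nonneg hnn hs, he]
  · intro he
    have hs : Summable fun h => f (g * h) * ν.real {h} := by
      have := ENNReal.summable_toReal (he ▸ ENNReal.ofReal_ne_top)
      simpa only [ENNReal.toReal_ofReal (hnn _)] using this
    refine ⟨hs, ?_⟩
    rw [← ENNReal.ofReal_tsum_of_nonneg hnn hs] at he
    exact (ENNReal.ofReal_eq_ofReal_iff (tsum_nonneg hnn) (hf g)).mp he

/-! ### The walk on the free monoid and the density of the stopped measure -/

section FreeMonoid

set_option linter.unusedSectionVars false

variable {W : Type*}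

/-- The path which reads the letters of the word `l` one by one and then stays at `l`. -/
def wordPath (l : List W) (n : ℕ) : FreeMonoid W := FreeMonoid.ofList (l.take n)

/-- The paths which start by reading the word `l`. -/
def cylinder (l : List W) : Set (ℕ → FreeMonoid W) := {x | ∀ i ≤ l.length, x i = wordPath l i}

theorem wordPath_take (l : List W) {i n : ℕ} (h : i ≤ n) :
    wordPath (l.take n) i = wordPath l i := by
  rw [wordPath, List.take_take, min_eq_left h, wordPath]

theorem wordPath_length (l : List W) : wordPath l l.length = FreeMonoid.ofList l := by
  rw [wordPath, List.take_length]

theorem wordPath_succ (l : List W) {i : ℕ} (hi : i < l.length) :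
    wordPath l (i + 1) = wordPath l i * FreeMonoid.of l[i] := by
  rw [wordPath, List.take_succ_eq_append_getElem hi]
  rfl

theorem mem_cylinder_take {x : ℕ → FreeMonoid W} {l : List W} (hx : x ∈ cylinder l) (i : ℕ) :
    x ∈ cylinder (l.take i) := by
  intro j hj
  rw [List.length_take] at hj
  rw [wordPath_take l (by omega), hx j (by omega)]

theorem path_mem_cylinder_iff (l : List W) (u : ℕ → FreeMonoid W) :
    path u ∈ cylinder l ↔ ∀ i (hi : i < l.length), u i = FreeMonoid.of l[i] := by
  constructor
  · intro h i hi
    have h1 := h (i + 1) hi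
    rw [wordPath_succ l hi, path, h i hi.le] at h1
    exact mul_left_cancel h1
  · intro h i
    induction i with
    | zero => exact fun _ => rfl
    | succ i ih =>
      intro hi
      rw [wordPath_succ l hi, path, ih (Nat.le_of_succ_le hi), h i hi]

theorem exists_mem_cylinder_of_letters {u : ℕ → FreeMonoid W}
    (hu : ∀ n, u n ∈ Set.range (FreeMonoid.of : W → FreeMonoid W)) (n : ℕ) :
    ∃ l : List W, l.length = n ∧ path u ∈ cylinder l := by
  choose w hw using hu
  refine ⟨(List.range n).map w, by simp, (path_mem_cylinder_iff _ _).mpr fun i hi => ?_⟩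
  simp [hw]

variable [MeasurableSpace (FreeMonoid W)]

/-- The weight of a letter under a measure on words. -/
noncomputable def letterWeight (μ : Measure (FreeMonoid W)) (w : W) : ℝ≥0∞ := μ {FreeMonoid.of w}

variable [Countable W] [DiscreteMeasurableSpace (FreeMonoid W)]
  {μ : Measure (FreeMonoid W)} [IsProbabilityMeasure μ]

instance instCountableFreeMonoid : Countable (FreeMonoid W) :=
  inferInstanceAs (Countable (List W))

theorem measurableSet_cylinder (l : List W) : MeasurableSet (cylinder l) := by
  have : cylinder l = ⋂ i ∈ Set.Iic l.length, (fun x => x i) ⁻¹' {wordPath l i} := by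
    ext x
    simp [cylinder]
  rw [this]
  exact MeasurableSet.biInter (Set.to_countable _) fun i _ =>
    measurable_pi_apply i (MeasurableSet.of_discrete)

theorem pathMeasure_cylinder (l : List W) :
    pathMeasure μ (cylinder l) = wordWeight (letterWeight μ) l := by
  rw [pathMeasure, Measure.map_apply measurable_path (measurableSet_cylinder l)]
  let s : ℕ → Set (FreeMonoid W) := fun i =>
    if hi : i < l.length then {FreeMonoid.of l[i]} else Set.univ
  have : path ⁻¹' cylinder l = Set.pi (range l.length) s := by
    ext u
    rw [Set.mem_preimage, path_mem_cylinder_iff]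
    refine forall_congr' fun i => ?_
    simp only [Finset.coe_range, Set.mem_Iio]
    refine forall_congr' fun hi => ?_
    simp [s, hi]
  rw [this, Measure.infinitePi_pi _ fun _ _ => MeasurableSet.of_discrete, Finset.prod_range,
    wordWeight, ← Fin.prod_univ_fun_getElem]
  refine Finset.prod_congr rfl fun i _ => ?_
  simp [s, letterWeight]

theorem ae_exists_mem_cylinder
    (hμ : ∀ᵐ x ∂μ, x ∈ Set.range (FreeMonoid.of : W → FreeMonoid W)) :
    ∀ᵐ x ∂pathMeasure μ, ∀ n, ∃ l : List W, l.length = n ∧ x ∈ cylinder l := by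
  have hmeas : MeasurableSet {x : ℕ → FreeMonoid W | ∀ n, ∃ l : List W, l.length = n ∧
      x ∈ cylinder l} := by
    simp only [Set.ofPred_forall, Set.ofPred_exists, Set.ofPred_and]
    exact MeasurableSet.iInter fun n => MeasurableSet.iUnion fun l =>
      (MeasurableSet.const _).inter (measurableSet_cylinder l)
  rw [pathMeasure, ae_map_iff measurable_path.aemeasurable hmeas]
  have : ∀ᵐ u ∂Measure.infinitePi fun _ : ℕ => μ, ∀ n,
      u n ∈ Set.range (FreeMonoid.of : W → FreeMonoid W) := ae_all_iff.mpr fun n =>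
    (measurePreserving_eval_infinitePi (fun _ : ℕ => μ) n).quasiMeasurePreserving.ae hμ
  filter_upwards [this] with u hu n using exists_mem_cylinder_of_letters hu n

variable {Ω : Type*} [MeasurableSpace Ω] {P : Measure Ω} [IsProbabilityMeasure P]
  {τ : (ℕ → FreeMonoid W) × Ω → ℕ∞}

/-- The event of stopping at time `n` is a preimage under restriction to the coordinates up to `n`.
-/
theorem stopping_eq_iff_of_agree {σ : (ℕ → FreeMonoid W) → ℕ∞}
    (hσ : IsStoppingTime (Filtration.piLE (X := fun _ : ℕ => FreeMonoid W)) σ) {n : ℕ}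
    {x y : ℕ → FreeMonoid W} (h : ∀ i ≤ n, x i = y i) : σ x = n ↔ σ y = n := by
  obtain ⟨s, -, hs⟩ := hσ.measurableSet_eq n
  have hr : Preorder.restrictLe (π := fun _ : ℕ => FreeMonoid W) n x =
      Preorder.restrictLe (π := fun _ : ℕ => FreeMonoid W) n y := by
    ext1 ⟨i, hi⟩
    exact h i hi
  have hx : ∀ z, σ z = n ↔ Preorder.restrictLe (π := fun _ : ℕ => FreeMonoid W) n z ∈ s :=
    fun z => (Set.ext_iff.mp hs z).symm
  rw [hx, hx, hr]

/-- The conditional probability of stopping at the word `l`, given that the walk reads `l`. -/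
noncomputable def stoppingDensity (P : Measure Ω) (τ : (ℕ → FreeMonoid W) × Ω → ℕ∞)
    (l : List W) : ℝ≥0 :=
  (P {ω | τ (wordPath l, ω) = l.length}).toNNReal

theorem coe_stoppingDensity (l : List W) :
    (stoppingDensity P τ l : ℝ≥0∞) = P {ω | τ (wordPath l, ω) = l.length} :=
  ENNReal.coe_toNNReal (measure_ne_top _ _)

theorem IsRandomizedStoppingTime.eq_iff_of_mem_cylinder (hτ : IsRandomizedStoppingTime μ P τ)
    {x : ℕ → FreeMonoid W} {l : List W} (hx : x ∈ cylinder l) (ω : Ω) :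
    τ (x, ω) = l.length ↔ τ (wordPath l, ω) = l.length :=
  stopping_eq_iff_of_agree (hτ.isStoppingTime ω) hx

/-- Almost surely the walk can be at `l` only at time `l.length`, having read `l` letter by letter.
Stopping then depends on `ω` alone, so the event is a product set up to a null set. -/
theorem stoppedMeasure_eq_wordWeight_mul
    (hμ : ∀ᵐ x ∂μ, x ∈ Set.range (FreeMonoid.of : W → FreeMonoid W))
    (hτ : IsRandomizedStoppingTime μ P τ) (l : List W) :
    stoppedMeasure μ P τ {FreeMonoid.ofList l} =
      wordWeight (letterWeight μ) l * stoppingDensity P τ l := by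
  rw [stoppedMeasure_singleton μ hτ, coe_stoppingDensity, ← pathMeasure_cylinder (μ := μ),
    ← Measure.prod_prod]
  refine measure_congr ?_
  have hae : ∀ᵐ q ∂(pathMeasure μ).prod P, ∀ n, ∃ l : List W, l.length = n ∧ q.1 ∈ cylinder l :=
    Measure.quasiMeasurePreserving_fst.ae (ae_exists_mem_cylinder hμ)
  filter_upwards [hae] with q hq
  refine propext ?_
  change (∃ n : ℕ, τ q = n ∧ q.1 n = FreeMonoid.ofList l) ↔
    q.1 ∈ cylinder l ∧ τ (wordPath l, q.2) = l.length
  constructor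
  · rintro ⟨n, hn, hl⟩
    obtain ⟨k, rfl, hk⟩ := hq n
    rw [hk _ le_rfl, wordPath_length] at hl
    obtain rfl : k = l := FreeMonoid.ofList.injective hl
    exact ⟨hk, (hτ.eq_iff_of_mem_cylinder hk q.2).mp hn⟩
  · rintro ⟨hc, hl⟩
    exact ⟨l.length, (hτ.eq_iff_of_mem_cylinder hc q.2).mpr hl, by
      rw [hc _ le_rfl, wordPath_length]⟩

theorem IsRandomizedStoppingTime.isStoppingDensity (hτ : IsRandomizedStoppingTime μ P τ) {M : ℕ}
    (hM : ∀ᵐ q ∂(pathMeasure μ).prod P, τ q ≤ M) :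
    IsStoppingDensity (letterWeight μ) (stoppingDensity P τ) M := by
  have key : ∀ l : List W, wordWeight (letterWeight μ) l ≠ 0 → ∃ x, (∀ᵐ ω ∂P, τ (x, ω) ≤ M) ∧
      (∑ i ∈ range (l.length + 1), stoppingDensity P τ (l.take i) : ℝ≥0) =
        P {ω | τ (x, ω) ≤ l.length} := by
    intro l h0
    rw [← pathMeasure_cylinder] at h0
    -- The cylinder has positive probability, so it contains a path for which the bound on `τ` holds
    -- for almost every `ω`. Along this one path the densities are the probabilities of the disjoint
    -- events `τ = i`.
    obtain ⟨x, hx, hxM⟩ := ((frequently_ae_mem_iff.mpr h0).and_eventually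
      (Measure.ae_ae_of_ae_prod hM)).exists
    refine ⟨x, hxM, ?_⟩
    have hmeas : ∀ n : ℕ, MeasurableSet {ω | τ (x, ω) = n} := fun n =>
      (hτ.measurable.comp measurable_prodMk_left) (MeasurableSet.of_discrete (s := {(n : ℕ∞)}))
    have hterm : ∀ i ∈ range (l.length + 1), (stoppingDensity P τ (l.take i) : ℝ≥0∞) =
        P {ω | τ (x, ω) = i} := by
      intro i hi
      have hl : (l.take i).length = i := by simp at hi ⊢; omega
      rw [coe_stoppingDensity]
      congr 1
      ext ω
      have := hτ.eq_iff_of_mem_cylinder (mem_cylinder_take hx i) ω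
      rw [hl] at this
      simp [this, hl]
    push_cast
    rw [Finset.sum_congr rfl hterm, ← measure_biUnion_finset _ fun n _ => hmeas n]
    · congr 1
      ext ω
      simp only [Set.mem_iUnion, Set.mem_ofPred_eq, exists_prop, Finset.mem_range, Nat.lt_succ_iff]
      constructor
      · rintro ⟨i, hi, h⟩
        rw [h]
        exact_mod_cast hi
      · intro h
        obtain ⟨n, hn⟩ := ENat.ne_top_iff_exists.mp (ne_top_of_le_ne_top (ENat.natCast_ne_top _) h)
        rw [← hn] at h ⊢
        exact ⟨n, by exact_mod_cast h, rfl⟩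
    · intro i _ j _ hij
      refine Set.disjoint_left.mpr fun ω hi hj => hij ?_
      have hi' : τ (x, ω) = i := hi
      exact_mod_cast hi'.symm.trans hj
  constructor
  · intro l h0
    obtain ⟨x, -, hx⟩ := key l h0
    have : P {ω | τ (x, ω) ≤ l.length} ≤ 1 := prob_le_one
    rw [← hx] at this
    exact_mod_cast this
  · intro l h0 hl
    obtain ⟨x, hxM, hx⟩ := key l h0
    have : P {ω | τ (x, ω) ≤ l.length} = 1 := by
      rw [← measure_univ (μ := P)]
      refine measure_congr (Filter.eventuallyEq_univ.mpr ?_)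
      filter_upwards [hxM] with ω hω
      exact hω.trans (by exact_mod_cast hl)
    rw [← hx] at this
    exact_mod_cast this

theorem measure_singleton_eq_wordWeight
    (hμ : ∀ᵐ x ∂μ, x ∈ Set.range (FreeMonoid.of : W → FreeMonoid W)) (l : List W) :
    μ {FreeMonoid.ofList l} = if l.length = 1 then wordWeight (letterWeight μ) l else 0 := by
  split_ifs with h
  · obtain ⟨w, rfl⟩ := List.length_eq_one_iff.mp h
    rw [wordWeight_cons, wordWeight_nil, mul_one]
    rfl
  · refine measure_mono_null ?_ (ae_iff.mp hμ)
    rintro _ rfl ⟨w, hw⟩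
    exact h (by rw [← FreeMonoid.ofList.injective hw]; rfl)

theorem tsum_measure_singleton_mul
    (hμ : ∀ᵐ x ∂μ, x ∈ Set.range (FreeMonoid.of : W → FreeMonoid W))
    (F : FreeMonoid W → ℝ≥0∞) :
    ∑' h, μ {h} * F h = ∑' w, letterWeight μ w * F (FreeMonoid.of w) := by
  have hinj : Function.Injective (FreeMonoid.of : W → FreeMonoid W) := FreeMonoid.of_injective
  refine (hinj.tsum_eq fun h hh => ?_).symm
  by_contra hn
  refine hh ?_
  have : μ {h} = 0 := measure_mono_null (by rintro _ rfl; exact hn) (ae_iff.mp hμ)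
  simp [this]

theorem tsum_letterWeight
    (hμ : ∀ᵐ x ∂μ, x ∈ Set.range (FreeMonoid.of : W → FreeMonoid W)) :
    ∑' w, letterWeight μ w = 1 := by
  have := tsum_measure_singleton_mul hμ fun _ => 1
  simp only [mul_one] at this
  rw [← this, ← measure_univ (μ := μ), ← Set.iUnion_of_singleton,
    measure_iUnion (fun _ _ h => Set.disjoint_singleton.mpr h) fun _ => MeasurableSet.of_discrete]

instance instIsFiniteMeasureMixedMeasure (μ : Measure (FreeMonoid W)) [IsProbabilityMeasure μ]
    (P : Measure Ω) [IsProbabilityMeasure P] (τ : (ℕ → FreeMonoid W) × Ω → ℕ∞) (t : ℝ) :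
    IsFiniteMeasure (mixedMeasure μ P τ t) := by
  have : IsFiniteMeasure (stoppedMeasure μ P τ) := by
    unfold stoppedMeasure
    infer_instance
  have h1 : IsFiniteMeasure (ENNReal.ofReal t • μ) := μ.smul_finite ENNReal.ofReal_ne_top
  have h2 : IsFiniteMeasure (ENNReal.ofReal (1 - t) • stoppedMeasure μ P τ) :=
    (stoppedMeasure μ P τ).smul_finite ENNReal.ofReal_ne_top
  unfold mixedMeasure
  infer_instance

theorem mixedMeasure_singleton
    (hμ : ∀ᵐ x ∂μ, x ∈ Set.range (FreeMonoid.of : W → FreeMonoid W))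
    (hτ : IsRandomizedStoppingTime μ P τ) {t : ℝ≥0} (l : List W) :
    mixedMeasure μ P τ t {FreeMonoid.ofList l} =
      wordWeight (letterWeight μ) l * mixedDensity t (stoppingDensity P τ) l := by
  have h1 : ENNReal.ofReal (1 - (t : ℝ)) = ((1 - t : ℝ≥0) : ℝ≥0∞) := by
    rw [ENNReal.coe_sub, ENNReal.ofReal_sub _ t.coe_nonneg, ENNReal.ofReal_one,
      ENNReal.ofReal_coe_nnreal, ENNReal.coe_one]
  rw [mixedMeasure, Measure.add_apply, Measure.smul_apply, Measure.smul_apply, smul_eq_mul,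
    smul_eq_mul, stoppedMeasure_eq_wordWeight_mul hμ hτ, measure_singleton_eq_wordWeight hμ, h1,
    ENNReal.ofReal_coe_nnreal, mixedDensity]
  push_cast
  split_ifs <;> push_cast <;> ring

end FreeMonoid

end RandomWalk

/-! ### The theorem -/

theorem mainTheorem5 {W : Type*} [Countable W]
    [MeasurableSpace (FreeMonoid W)] [DiscreteMeasurableSpace (FreeMonoid W)]
    (μ : Measure (FreeMonoid W)) [IsProbabilityMeasure μ]
    (hμ : ∀ᵐ x ∂μ, x ∈ Set.range (FreeMonoid.of : W → FreeMonoid W))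
    {Ω : Type*} [MeasurableSpace Ω] (P : Measure Ω) [IsProbabilityMeasure P]
    (τ : (ℕ → FreeMonoid W) × Ω → ℕ∞)
    (hτ : RandomWalk.IsRandomizedStoppingTime μ P τ)
    (hbdd : ∃ M : ℕ, ∀ᵐ p ∂(RandomWalk.pathMeasure μ).prod P, τ p ≤ M)
    (t : ℝ) (ht0 : 0 < t) (ht1 : t ≤ 1) :
    RandomWalk.positiveHarmonic μ =
      RandomWalk.positiveHarmonic (RandomWalk.mixedMeasure μ P τ t) := by
  obtain ⟨M, hM⟩ := hbdd
  lift t to NNReal using ht0.le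
  ext f
  refine and_congr_right fun hf => ?_
  rw [RandomWalk.isHarmonic_iff μ hf, RandomWalk.isHarmonic_iff _ hf]
  have key := (hτ.isStoppingDensity hM).harmonic_iff (RandomWalk.tsum_letterWeight hμ)
    (t := t) (by exact_mod_cast ht0) (by exact_mod_cast ht1)
    (F := fun l => ENNReal.ofReal (f (FreeMonoid.ofList l))) fun _ => ENNReal.ofReal_ne_top
  simp_rw [RandomWalk.tsum_measure_singleton_mul hμ]
  refine key.trans (forall_congr' fun g => ?_)
  simp_rw [← RandomWalk.mixedMeasure_singleton hμ hτ]
  exact Iff.rfl
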